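/- Let $k$ be a field and let $(\mathcal B,\mathbb E,\mathfrak s)$ be an extriangulated category (in the sense of Nakaoka–Palu) that is $k$-linear, Hom-finite and Krull–Schmidt, has enough projectives and enough injectives, and satisfies condition (WIC): for composable morphisms $f,g$, if $g\circ f$ is an inflation, then so is $f$, and if $g\circ f$ is a deflation, then so is $g$. "Subcategory" means a full subcategory closed under isomorphisms, finite direct sums (including the zero object) and direct summands. Let $\mathcal P$ be the subcategory of projective objects. For objects $X,Y$ and $i\ge 0$ put $\mathbb E^{i+1}(X,Y)=\mathbb E(\Omega^iX,Y)$, where $\Omega^0X=X$ and $\Omega^{i+1}X$ is an object in an $\mathbb E$-triangle $\Omega^{i+1}X\to P\to\Omega^iX\dashrightarrow$ with $P\in\mathcal P$ (up to isomorphism, the groups do not depend on the choices). Put $$\operatorname{pd}X=\sup\{n\ge 1\mid \mathbb E^n(X,Y)\neq 0\text{ for some object }Y\},\qquad \operatorname{pd}\mathcal C=\sup\{\operatorname{pd}X\mid X\in\mathcal C\},$$ in $\{0,1,2,\dots\}\cup\{\infty\}$, with $\sup\emptyset=0$. A subcategory is *thick* if, whenever two of the objects $A,B,C$ in an $\mathbb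 E$-triangle $A\to B\to C\dashrightarrow$ belong to it, so does the third; $\mathsf{thick}\,\mathcal S$ is the smallest thick subcategory containing $\mathcal S$. A subcategory $\mathcal S$ is *silting* if $\mathbb E^i(\mathcal S,\mathcal S)=0$ for all $i\ge1$ and $\mathsf{thick}\,\mathcal S=\mathcal B$. A subcategory $\mathcal T$ is *tilting* if for some $n\ge 1$ the following hold: $\operatorname{pd}\mathcal T\le n$; $\mathbb E^i(\mathcal T,\mathcal T)=0$ for $1\le i\le n$; and $\mathcal P\subseteq\mathcal T^\vee_n$. Here $\mathcal T^\vee_0=\mathcal T$ and, for $i\ge 1$, $\mathcal T^\vee_i$ consists of the objects $X$ admitting an $\mathbb E$-triangle $X\to T\to X'\dashrightarrow$ with $T\in\mathcal T$ and $X'\in\mathcal T^\vee_{i-1}$. Let $\operatorname{silt}\mathcal B$ and $\operatorname{tilt}\mathcal B$ be the classes of all silting and of all tilting subcategories of $\mathcal B$. Then: (1) If $\operatorname{pd}B<\infty$ for every object $B\in\mathcal B$, then $\operatorname{tilt}\mathcal B\subseteq\operatorname{silt}\mathcal B$. (2) If $\operatorname{pd}\mathcal B<\infty$, then $\operatorname{silt}\mathcal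 B=\operatorname{tilt}\mathcal B$. (3) If there is an object $X$ of $\mathcal B$ with $\operatorname{pd}X=\infty$, then $\operatorname{silt}\mathcal B\cap\operatorname{tilt}\mathcal B=\emptyset$. -/

import Mathlib

open CategoryTheory CategoryTheory.Limits

universe w v u

/-- A Krull-Schmidt category: every object is a finite direct sum of objects with local
endomorphism rings. -/
def IsKrullSchmidt (C : Type u) [Category.{v} C] [Preadditive C] : Prop :=
  ∀ X : C, ∃ (n : ℕ) (f : Fin n → C) (b : Bicone f),
    (∀ i, IsLocalRing (End (f i))) ∧ Nonempty b.IsBilimit ∧ Nonempty (X ≅ b.pt)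

/-- The subcategories considered here: full (so they are given by a property of objects), closed
under isomorphisms, finite direct sums (the empty one included) and direct summands. -/
structure IsSummandClosedSubcategory {C : Type u} [Category.{v} C] [Preadditive C]
    [HasZeroObject C] [HasBinaryBiproducts C] (S : ObjectProperty C) : Prop where
  of_iso : ∀ {X Y : C}, (X ≅ Y) → S X → S Y
  zero : ∀ {X : C}, IsZero X → S X
  sum : ∀ {X Y : C}, S X → S Y → S (X ⊞ Y)
  summand : ∀ {X Y : C}, S (X ⊞ Y) → S X

/-- An additive bifunctor `𝔼 : Cᵒᵖ × C → Ab`. -/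
structure ExtensionBifunctor (C : Type u) [Category.{v} C] [Preadditive C] where
  /-- the underlying functor -/
  functor : Cᵒᵖ ⥤ C ⥤ AddCommGrpCat.{w}
  additive_left : functor.Additive
  additive_right : ∀ X : Cᵒᵖ, (functor.obj X).Additive

namespace ExtensionBifunctor

variable {C : Type u} [Category.{v} C] [Preadditive C] (E : ExtensionBifunctor.{w} C)

/-- The group `𝔼(Z, A)` of extensions. -/
abbrev Ext (Z A : C) : Type w := ((E.functor.obj (Opposite.op Z)).obj A : AddCommGrpCat.{w})

/-- `a_* δ = 𝔼(Z, a)(δ)`. -/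
def push {Z A A' : C} (a : A ⟶ A') (δ : E.Ext Z A) : E.Ext Z A' :=
  ((E.functor.obj (Opposite.op Z)).map a).hom δ

/-- `c^* δ = 𝔼(c, A)(δ)`. -/
def pull {Z Z' A : C} (c : Z' ⟶ Z) (δ : E.Ext Z A) : E.Ext Z' A :=
  ((E.functor.map c.op).app A).hom δ

/-- `δ ⊕ δ'`, the element of `𝔼(Z ⊕ Z', A ⊕ A')` with components `(δ, 0, 0, δ')`. -/
noncomputable def directSum [HasBinaryBiproducts C] {Z Z' A A' : C}
    (δ : E.Ext Z A) (δ' : E.Ext Z' A') : E.Ext (Z ⊞ Z') (A ⊞ A') :=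
  E.pull biprod.fst (E.push biprod.inl δ) + E.pull biprod.snd (E.push biprod.inr δ')

end ExtensionBifunctor

/-- An extriangulated structure `(𝔼, 𝔰)` on an additive category, in the sense of Nakaoka and Palu.
The realization `𝔰` is given by the relation `Realizes x y δ`, read as "the sequence `A ⟶ B ⟶ Z`
belongs to the class `𝔰(δ)`", i.e. "`A ⟶ B ⟶ Z` with `δ` is an `𝔼`-triangle". -/
structure Extriangulation (C : Type u) [Category.{v} C] [Preadditive C]
    [HasZeroObject C] [HasBinaryBiproducts C] extends ExtensionBifunctor.{w} C where
  Realizes : ∀ {A B Z : C}, (A ⟶ B) → (B ⟶ Z) → toExtensionBifunctor.Ext Z A → Prop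
  /-- `𝔰(δ)` is an equivalence class of sequences: it is nonempty, -/
  exists_realization : ∀ {A Z : C} (δ : toExtensionBifunctor.Ext Z A),
    ∃ (B : C) (x : A ⟶ B) (y : B ⟶ Z), Realizes x y δ
  /-- any two of its members are equivalent, -/
  realization_unique : ∀ {A B B' Z : C} {δ : toExtensionBifunctor.Ext Z A}
    {x : A ⟶ B} {y : B ⟶ Z} {x' : A ⟶ B'} {y' : B' ⟶ Z},
    Realizes x y δ → Realizes x' y' δ → ∃ b : B ≅ B', x ≫ b.hom = x' ∧ b.hom ≫ y' = y
  /-- and it is closed under equivalence. -/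
  realizes_of_iso : ∀ {A B B' Z : C} {δ : toExtensionBifunctor.Ext Z A}
    {x : A ⟶ B} {y : B ⟶ Z} {x' : A ⟶ B'} {y' : B' ⟶ Z} (b : B ≅ B'),
    x ≫ b.hom = x' → b.hom ≫ y' = y → Realizes x y δ → Realizes x' y' δ
  /-- `𝔰` is a realization: morphisms of extensions lift to morphisms of sequences. -/
  exists_middle : ∀ {A B Z A' B' Z' : C}
    {δ : toExtensionBifunctor.Ext Z A} {δ' : toExtensionBifunctor.Ext Z' A'}
    {x : A ⟶ B} {y : B ⟶ Z} {x' : A' ⟶ B'} {y' : B' ⟶ Z'} (a : A ⟶ A') (c : Z ⟶ Z'),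
    Realizes x y δ → Realizes x' y' δ' →
    toExtensionBifunctor.push a δ = toExtensionBifunctor.pull c δ' →
    ∃ b : B ⟶ B', x ≫ b = a ≫ x' ∧ y ≫ c = b ≫ y'
  /-- `𝔰` is additive: `𝔰(0)` is the class of the split sequence, -/
  realizes_zero : ∀ A Z : C,
    Realizes (biprod.inl : A ⟶ A ⊞ Z) biprod.snd (0 : toExtensionBifunctor.Ext Z A)
  /-- and `𝔰(δ ⊕ δ') = 𝔰(δ) ⊕ 𝔰(δ')`. -/
  realizes_directSum : ∀ {A B Z A' B' Z' : C}
    {δ : toExtensionBifunctor.Ext Z A} {δ' : toExtensionBifunctor.Ext Z' A'}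
    {x : A ⟶ B} {y : B ⟶ Z} {x' : A' ⟶ B'} {y' : B' ⟶ Z'},
    Realizes x y δ → Realizes x' y' δ' →
    Realizes (biprod.map x x') (biprod.map y y') (toExtensionBifunctor.directSum δ δ')
  /-- (ET3) -/
  et3 : ∀ {A B Z A' B' Z' : C}
    {δ : toExtensionBifunctor.Ext Z A} {δ' : toExtensionBifunctor.Ext Z' A'}
    {x : A ⟶ B} {y : B ⟶ Z} {x' : A' ⟶ B'} {y' : B' ⟶ Z'} (a : A ⟶ A') (b : B ⟶ B'),
    Realizes x y δ → Realizes x' y' δ' → x ≫ b = a ≫ x' →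
    ∃ c : Z ⟶ Z', y ≫ c = b ≫ y' ∧
      toExtensionBifunctor.push a δ = toExtensionBifunctor.pull c δ'
  /-- (ET3)ᵒᵖ -/
  et3_op : ∀ {A B Z A' B' Z' : C}
    {δ : toExtensionBifunctor.Ext Z A} {δ' : toExtensionBifunctor.Ext Z' A'}
    {x : A ⟶ B} {y : B ⟶ Z} {x' : A' ⟶ B'} {y' : B' ⟶ Z'} (b : B ⟶ B') (c : Z ⟶ Z'),
    Realizes x y δ → Realizes x' y' δ' → y ≫ c = b ≫ y' →
    ∃ a : A ⟶ A', x ≫ b = a ≫ x' ∧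
      toExtensionBifunctor.push a δ = toExtensionBifunctor.pull c δ'
  /-- (ET4) -/
  et4 : ∀ {A B Z D F : C}
    {δ : toExtensionBifunctor.Ext D A} {δ' : toExtensionBifunctor.Ext F B}
    {f : A ⟶ B} {f' : B ⟶ D} {g : B ⟶ Z} {g' : Z ⟶ F},
    Realizes f f' δ → Realizes g g' δ' →
    ∃ (G : C) (d : D ⟶ G) (e : G ⟶ F) (h' : Z ⟶ G) (δ'' : toExtensionBifunctor.Ext G A),
      f' ≫ d = g ≫ h' ∧ h' ≫ e = g' ∧
      Realizes (f ≫ g) h' δ'' ∧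
      Realizes d e (toExtensionBifunctor.push f' δ') ∧
      toExtensionBifunctor.pull d δ'' = δ ∧
      toExtensionBifunctor.push f δ'' = toExtensionBifunctor.pull e δ'
  /-- (ET4)ᵒᵖ -/
  et4_op : ∀ {A B Z D F : C}
    {δ : toExtensionBifunctor.Ext B D} {δ' : toExtensionBifunctor.Ext Z F}
    {f' : D ⟶ A} {f : A ⟶ B} {g' : F ⟶ B} {g : B ⟶ Z},
    Realizes f' f δ → Realizes g' g δ' →
    ∃ (G : C) (d : D ⟶ G) (e : G ⟶ F) (h' : G ⟶ A) (δ'' : toExtensionBifunctor.Ext Z G),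
      d ≫ h' = f' ∧ e ≫ g' = h' ≫ f ∧
      Realizes h' (f ≫ g) δ'' ∧
      Realizes d e (toExtensionBifunctor.pull g' δ) ∧
      toExtensionBifunctor.push e δ'' = δ' ∧
      toExtensionBifunctor.push d δ = toExtensionBifunctor.pull g δ''

namespace Extriangulation

variable {C : Type u} [Category.{v} C] [Preadditive C] [HasZeroObject C] [HasBinaryBiproducts C]
  (𝓑 : Extriangulation.{w} C)

/-- `A ⟶ B ⟶ Z` is the underlying sequence of some `𝔼`-triangle. -/
def IsConflation {A B Z : C} (x : A ⟶ B) (y : B ⟶ Z) : Prop :=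
  ∃ δ : 𝓑.Ext Z A, 𝓑.Realizes x y δ

def IsInflation {A B : C} (x : A ⟶ B) : Prop :=
  ∃ (Z : C) (y : B ⟶ Z), 𝓑.IsConflation x y

def IsDeflation {B Z : C} (y : B ⟶ Z) : Prop :=
  ∃ (A : C) (x : A ⟶ B), 𝓑.IsConflation x y

/-- Condition (WIC). -/
def WIC : Prop :=
  ∀ {X Y Z : C} (f : X ⟶ Y) (g : Y ⟶ Z),
    (𝓑.IsInflation (f ≫ g) → 𝓑.IsInflation f) ∧ (𝓑.IsDeflation (f ≫ g) → 𝓑.IsDeflation g)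

/-- The subcategory of projective objects. -/
def projectives : ObjectProperty C := fun P =>
  ∀ {A B Z : C} (x : A ⟶ B) (y : B ⟶ Z), 𝓑.IsConflation x y →
    ∀ c : P ⟶ Z, ∃ b : P ⟶ B, b ≫ y = c

/-- The subcategory of injective objects. -/
def injectives : ObjectProperty C := fun I =>
  ∀ {A B Z : C} (x : A ⟶ B) (y : B ⟶ Z), 𝓑.IsConflation x y →
    ∀ a : A ⟶ I, ∃ b : B ⟶ I, x ≫ b = a

class HasEnoughProjectives : Prop where
  exists_conflation : ∀ Z : C, ∃ (A P : C) (x : A ⟶ P) (y : P ⟶ Z),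
    𝓑.projectives P ∧ 𝓑.IsConflation x y

class HasEnoughInjectives : Prop where
  exists_conflation : ∀ A : C, ∃ (I Z : C) (x : A ⟶ I) (y : I ⟶ Z),
    𝓑.injectives I ∧ 𝓑.IsConflation x y

/-- `CoCone(S, T)`. -/
def coCone (S T : ObjectProperty C) : ObjectProperty C := fun X =>
  ∃ (A B : C) (x : X ⟶ A) (y : A ⟶ B), S A ∧ T B ∧ 𝓑.IsConflation x y

/-- `S^∨_n`: one has `S^∨_0 = S` and `S^∨_n = CoCone(S, S^∨_{n-1})` for `n > 0`. -/
def vee (S : ObjectProperty C) : ℕ → ObjectProperty C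
  | 0 => S
  | n + 1 => 𝓑.coCone S (vee S n)

/-- Thick subcategories: two out of three in every `𝔼`-triangle. -/
structure IsThick (S : ObjectProperty C) : Prop where
  isSubcategory : IsSummandClosedSubcategory S
  left : ∀ {A B Z : C} (x : A ⟶ B) (y : B ⟶ Z), 𝓑.IsConflation x y → S B → S Z → S A
  middle : ∀ {A B Z : C} (x : A ⟶ B) (y : B ⟶ Z), 𝓑.IsConflation x y → S A → S Z → S B
  right : ∀ {A B Z : C} (x : A ⟶ B) (y : B ⟶ Z), 𝓑.IsConflation x y → S A → S B → S Z

/-- `thick S`, the smallest thick subcategory containing `S`. -/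
def thick (S : ObjectProperty C) : ObjectProperty C := fun X =>
  ∀ T : ObjectProperty C, 𝓑.IsThick T → S ≤ T → T X

section HigherExtensions

variable [𝓑.HasEnoughProjectives]

/-- A chosen syzygy `Ω X`, i.e. an object in an `𝔼`-triangle `Ω X ⟶ P ⟶ X` with `P` projective.
The groups `𝔼(Ω X, Y)` do not depend on the choice, up to isomorphism. -/
noncomputable def syzygy (X : C) : C :=
  (‹𝓑.HasEnoughProjectives›.exists_conflation X).choose

/-- `Ω^i X`. -/
noncomputable def iterSyzygy : ℕ → C → C
  | 0, X => X
  | i + 1, X => 𝓑.syzygy (iterSyzygy i X)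

/-- The higher extension group `𝔼^{i+1}(X, Y) = 𝔼(Ω^i X, Y)`, for `i ≥ 0`. -/
abbrev ExtSucc (i : ℕ) (X Y : C) : Type w := 𝓑.Ext (𝓑.iterSyzygy i X) Y

/-- `pd X = sup {n ≥ 1 | 𝔼^n(X, Y) ≠ 0 for some Y}`, with `sup ∅ = 0`. -/
noncomputable def pd (X : C) : ℕ∞ :=
  sSup {n : ℕ∞ | ∃ i : ℕ, n = ((i + 1 : ℕ) : ℕ∞) ∧ ∃ Y : C, Nontrivial (𝓑.ExtSucc i X Y)}

/-- `pd S = sup {pd X | X ∈ S}`. -/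
noncomputable def pdSubcategory (S : ObjectProperty C) : ℕ∞ :=
  sSup {n : ℕ∞ | ∃ X : C, S X ∧ n = 𝓑.pd X}

/-- Presilting: `𝔼^i(S, S) = 0` for all `i ≥ 1`. -/
structure IsPresilting (S : ObjectProperty C) : Prop where
  isSubcategory : IsSummandClosedSubcategory S
  ext_vanish : ∀ (i : ℕ) (X Y : C), S X → S Y → Subsingleton (𝓑.ExtSucc i X Y)

/-- Silting: presilting, and the whole category is `thick S`. -/
structure IsSilting (S : ObjectProperty C) : Prop extends 𝓑.IsPresilting S where
  thick_eq_top : 𝓑.thick S = ⊤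

/-- Partial `n`-tilting: `n ≥ 1`, `pd T ≤ n`, and `𝔼^i(T, T) = 0` for `i = 1, ..., n`
(written `i = j + 1` with `j < n`). -/
structure IsPartialTilting (n : ℕ) (T : ObjectProperty C) : Prop where
  isSubcategory : IsSummandClosedSubcategory T
  one_le : 1 ≤ n
  pd_le : 𝓑.pdSubcategory T ≤ n
  ext_vanish : ∀ j < n, ∀ X Y : C, T X → T Y → Subsingleton (𝓑.ExtSucc j X Y)

/-- `n`-tilting: partial `n`-tilting, and `T^∨_n` contains all projectives. -/
structure IsNTilting (n : ℕ) (T : ObjectProperty C) : Prop extends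
    𝓑.IsPartialTilting n T where
  projectives_le : 𝓑.projectives ≤ 𝓑.vee T n

/-- The class of all silting subcategories. -/
def silt : Set (ObjectProperty C) := {S | 𝓑.IsSilting S}

/-- The class of all tilting subcategories: those that are `n`-tilting for some `n ≥ 1`. -/
def tilt : Set (ObjectProperty C) := {T | ∃ n : ℕ, 𝓑.IsNTilting n T}

end HigherExtensions

end Extriangulation

/-! A tilting subcategory `T` is presilting, since `pd T ≤ n` kills the degrees above `n`. Its thick
closure contains the projectives, by their finite coresolutions, and hence every `X` of finite
projective dimension, because a high syzygy of `X` is projective. This gives (1). For (3), the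
objects of finite projective dimension form a thick subcategory (`isThick_pd_lt_top`), so a silting
subcategory of finite projective dimension forces all objects to have finite projective dimension.

The hard direction of (2) is that a silting `S` coresolves the projectives. Write `S^∨` and `S^∧`
for the objects with finite `S`-coresolutions and `S`-resolutions. The class of cones of inflations
from `S^∧` to `S^∨` contains `S` and is thick (`isThick_cone`), so it is everything. By
`cone_eq_coCone` a projective `P` then sits in a triangle `P ⟶ V ⟶ U` with `V` in `S^∧` and `U` in
`S^∨`. All higher extensions from `V` to `S` vanish, so the resolution of `V` splits, `V` lies in
`S`, and `P` lies in `S^∨` (`finVee_of_cone`). The bound on `pd` shortens the coresolution to length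
`n` (`vee_of_vee_succ`). -/

/-! ### Functoriality and additivity of the extension groups. -/

namespace ExtensionBifunctor

variable {C : Type u} [Category.{v} C] [Preadditive C] (E : ExtensionBifunctor.{w} C)

lemma push_id {Z A : C} (δ : E.Ext Z A) : E.push (𝟙 A) δ = δ := by
  simp [push]

lemma pull_id {Z A : C} (δ : E.Ext Z A) : E.pull (𝟙 Z) δ = δ := by
  simp [pull]

lemma push_comp {Z A A' A'' : C} (a : A ⟶ A') (a' : A' ⟶ A'') (δ : E.Ext Z A) :
    E.push (a ≫ a') δ = E.push a' (E.push a δ) := by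
  simp [push]

lemma pull_comp {Z Z' Z'' A : C} (c : Z'' ⟶ Z') (c' : Z' ⟶ Z) (δ : E.Ext Z A) :
    E.pull (c ≫ c') δ = E.pull c (E.pull c' δ) := by
  simp [pull]

lemma push_zero {Z A A' : C} (a : A ⟶ A') : E.push a (0 : E.Ext Z A) = 0 :=
  map_zero _

lemma pull_zero {Z Z' A : C} (c : Z' ⟶ Z) : E.pull c (0 : E.Ext Z A) = 0 :=
  map_zero _

lemma push_sub {Z A A' : C} (a : A ⟶ A') (δ δ' : E.Ext Z A) :
    E.push a (δ - δ') = E.push a δ - E.push a δ' :=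
  map_sub _ _ _

lemma pull_sub {Z Z' A : C} (c : Z' ⟶ Z) (δ δ' : E.Ext Z A) :
    E.pull c (δ - δ') = E.pull c δ - E.pull c δ' :=
  map_sub _ _ _

lemma sub_push {Z A A' : C} (a a' : A ⟶ A') (δ : E.Ext Z A) :
    E.push (a - a') δ = E.push a δ - E.push a' δ := by
  have := E.additive_right (Opposite.op Z)
  simp [push, Functor.map_sub]

lemma sub_pull {Z Z' A : C} (c c' : Z' ⟶ Z) (δ : E.Ext Z A) :
    E.pull (c - c') δ = E.pull c δ - E.pull c' δ := by
  have := E.additive_left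
  simp [pull, Functor.map_sub]

lemma push_pull {Z Z' A A' : C} (a : A ⟶ A') (c : Z' ⟶ Z) (δ : E.Ext Z A) :
    E.push a (E.pull c δ) = E.pull c (E.push a δ) := by
  have := (E.functor.map c.op).naturality a
  exact (ConcreteCategory.congr_hom this δ).symm

lemma subsingleton_of_isZero_left {Z : C} (hZ : IsZero Z) (A : C) :
    Subsingleton (E.Ext Z A) := by
  refine subsingleton_of_forall_eq 0 fun δ => ?_
  rw [← E.pull_id δ, hZ.eq_of_src (𝟙 Z) (𝟙 Z - 𝟙 Z), sub_pull, sub_self]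

lemma subsingleton_of_retract {X Z : C} (r : Retract X Z) {A : C}
    (h : Subsingleton (E.Ext Z A)) : Subsingleton (E.Ext X A) := by
  refine subsingleton_of_forall_eq 0 fun δ => ?_
  rw [← E.pull_id δ, ← r.retract, pull_comp, Subsingleton.elim (E.pull r.r δ) 0, pull_zero]

end ExtensionBifunctor

/-! ### Exact sequences, horseshoes and retracts for a single `𝔼`-triangle. -/

namespace Extriangulation

open ExtensionBifunctor

variable {C : Type u} [Category.{v} C] [Preadditive C] [HasZeroObject C] [HasBinaryBiproducts C]
  {𝓑 : Extriangulation.{w} C}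

lemma realizes_of_split {A G Z : C} {i : A ⟶ G} {r : G ⟶ A} {p : G ⟶ Z} {s : Z ⟶ G}
    (hir : i ≫ r = 𝟙 A) (hsp : s ≫ p = 𝟙 Z) (hip : i ≫ p = 0) (hsr : s ≫ r = 0)
    (h : r ≫ i + p ≫ s = 𝟙 G) : 𝓑.Realizes i p 0 := by
  let b : A ⊞ Z ≅ G :=
    { hom := biprod.desc i s
      inv := biprod.lift r p
      hom_inv_id := by ext <;> simp [*]
      inv_hom_id := by simpa using h }
  refine 𝓑.realizes_of_iso b ?_ ?_ (𝓑.realizes_zero A Z)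
  · simp [b]
  · ext <;> simp [b, *]

lemma realizes_id (A : C) {Z : C} (hZ : IsZero Z) : 𝓑.Realizes (𝟙 A) (0 : A ⟶ Z) 0 :=
  realizes_of_split (r := 𝟙 A) (s := 0) (by simp) (hZ.eq_of_src _ _) (by simp) (by simp) (by simp)

lemma realizes_id' (Z : C) {A : C} (hA : IsZero A) : 𝓑.Realizes (0 : A ⟶ Z) (𝟙 Z) 0 :=
  realizes_of_split (r := 0) (s := 𝟙 Z) (hA.eq_of_src _ _) (by simp) (by simp) (by simp) (by simp)

namespace Realizes

section

variable {A B Z : C} {x : A ⟶ B} {y : B ⟶ Z} {δ : 𝓑.Ext Z A}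

lemma isConflation (h : 𝓑.Realizes x y δ) : 𝓑.IsConflation x y := ⟨δ, h⟩

/-- Comparison with the trivial triangle `B ⟶ B ⟶ 0`, whose class is zero. Such comparisons with
trivial or split triangles yield several of the exactness statements below. -/
lemma push_eq_zero (h : 𝓑.Realizes x y δ) : 𝓑.push x δ = 0 := by
  obtain ⟨c, -, hc⟩ := 𝓑.et3 (a := x) (b := 𝟙 B) h (realizes_id B (isZero_zero C)) (by simp)
  rw [hc, pull_zero]

lemma pull_eq_zero (h : 𝓑.Realizes x y δ) : 𝓑.pull y δ = 0 := by
  obtain ⟨a, -, ha⟩ := 𝓑.et3_op (b := 𝟙 B) (c := y) (realizes_id' B (isZero_zero C)) h (by simp)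
  rw [← ha, push_zero]

lemma comp_eq_zero (h : 𝓑.Realizes x y δ) : x ≫ y = 0 := by
  obtain ⟨c, hc, -⟩ := 𝓑.et3 (a := 𝟙 A) (b := x) (realizes_id A (isZero_zero C)) h (by simp)
  rw [← hc, zero_comp]

lemma exists_lift (h : 𝓑.Realizes x y δ) {W : C} {c : W ⟶ Z} (hc : 𝓑.pull c δ = 0) :
    ∃ b : W ⟶ B, b ≫ y = c := by
  obtain ⟨b, -, hb⟩ := 𝓑.exists_middle (𝟙 A) c (𝓑.realizes_zero A W) h (by rw [push_zero, hc])
  exact ⟨biprod.inr ≫ b, by simp [← hb]⟩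

lemma exists_extend (h : 𝓑.Realizes x y δ) {T : C} {a : A ⟶ T} (ha : 𝓑.push a δ = 0) :
    ∃ b : B ⟶ T, x ≫ b = a := by
  obtain ⟨b, hb, -⟩ := 𝓑.exists_middle a (𝟙 Z) h (𝓑.realizes_zero T Z) (by rw [pull_zero, ha])
  exact ⟨b ≫ biprod.fst, by simp [reassoc_of% hb]⟩

lemma exists_desc_of_comp_eq_zero (h : 𝓑.Realizes x y δ) {T : C} {t : B ⟶ T} (ht : x ≫ t = 0) :
    ∃ c : Z ⟶ T, y ≫ c = t := by
  obtain ⟨c, hc, -⟩ := 𝓑.et3 (a := 0) (b := t) h (realizes_id' T (isZero_zero C)) (by simp [ht])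
  exact ⟨c, by simpa using hc⟩

lemma exists_pull_eq (h : 𝓑.Realizes x y δ) {W : C} {ε : 𝓑.Ext W A} (hε : 𝓑.push x ε = 0) :
    ∃ c : W ⟶ Z, 𝓑.pull c δ = ε := by
  obtain ⟨M, m, p, hM⟩ := 𝓑.exists_realization ε
  obtain ⟨b, hb⟩ := hM.exists_extend hε
  obtain ⟨c, -, hc⟩ := 𝓑.et3 (a := 𝟙 A) (b := b) hM h (by simp [hb])
  exact ⟨c, by rw [← hc, push_id]⟩

lemma exists_push_eq (h : 𝓑.Realizes x y δ) {T : C} {ε : 𝓑.Ext Z T} (hε : 𝓑.pull y ε = 0) :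
    ∃ a : A ⟶ T, 𝓑.push a δ = ε := by
  obtain ⟨M, m, p, hM⟩ := 𝓑.exists_realization ε
  obtain ⟨b, hb⟩ := hM.exists_lift hε
  obtain ⟨a, -, ha⟩ := 𝓑.et3_op (b := b) (c := 𝟙 Z) h hM (by simp [hb])
  exact ⟨a, by rw [ha, pull_id]⟩

lemma exists_pull_right_eq (h : 𝓑.Realizes x y δ) {T : C} {ε : 𝓑.Ext B T}
    (hε : 𝓑.pull x ε = 0) : ∃ ε' : 𝓑.Ext Z T, 𝓑.pull y ε' = ε := by
  obtain ⟨M, m, p, hM⟩ := 𝓑.exists_realization ε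
  obtain ⟨G, d, e, h', δ'', -, -, -, hs, -, hp⟩ := 𝓑.et4_op hM h
  rw [hε] at hs
  -- The kernel `G` of `M ⟶ B ⟶ Z` is a split extension of `A` by `T`; pushing its class along the
  -- retraction `s` gives the preimage of `ε`.
  obtain ⟨s, hs⟩ := hs.exists_extend (a := 𝟙 T) (push_zero _ _)
  exact ⟨𝓑.push s δ'', by rw [← push_pull, ← hp, ← push_comp, hs, push_id]⟩

lemma exists_split (h : 𝓑.Realizes x y 0) :
    ∃ (r : B ⟶ A) (s : Z ⟶ B), x ≫ r = 𝟙 A ∧ s ≫ y = 𝟙 Z ∧ s ≫ r = 0 ∧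
      r ≫ x + y ≫ s = 𝟙 B := by
  obtain ⟨b, h1, h2⟩ := 𝓑.realization_unique (𝓑.realizes_zero A Z) h
  refine ⟨b.inv ≫ biprod.fst, biprod.inr ≫ b.hom, ?_, ?_, ?_, ?_⟩
  · simp [← h1]
  · simp [h2]
  · simp
  · rw [← h1, ← cancel_epi b.hom, Preadditive.comp_add, reassoc_of% h2]
    simp only [Category.assoc, Iso.hom_inv_id_assoc]
    rw [← cancel_mono b.inv]
    simp

lemma nonempty_iso_biprod (h : 𝓑.Realizes x y 0) : Nonempty (A ⊞ Z ≅ B) := by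
  obtain ⟨b, -, -⟩ := 𝓑.realization_unique (𝓑.realizes_zero A Z) h
  exact ⟨b⟩

/-- The difference `b - 𝟙` factors through `y` and is killed by `y`, so it squares to zero and `2 -
b` is inverse to `b`. -/
lemma isIso_of_endo (h : 𝓑.Realizes x y δ) {b : B ⟶ B} (hx : x ≫ b = x) (hy : b ≫ y = y) :
    IsIso b := by
  obtain ⟨c, hc⟩ := h.exists_desc_of_comp_eq_zero (t := b - 𝟙 B) (by simp [hx])
  have ht : (b - 𝟙 B) ≫ (b - 𝟙 B) = 0 := by
    nth_rw 2 [← hc]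
    rw [← Category.assoc]
    simp [hy]
  have hb : b ≫ b = b + b - 𝟙 B := by
    simp only [Preadditive.comp_sub, Preadditive.sub_comp, Category.comp_id, Category.id_comp] at ht
    rw [sub_eq_zero] at ht
    rw [sub_eq_iff_eq_add.mp ht]
    abel
  refine ⟨𝟙 B + 𝟙 B - b, ?_, ?_⟩
  · simp [hb]
  · simp [hb]

/-- A realization of the transported class maps to the given one and back; both composites are
invertible by `isIso_of_endo`, so the middle terms are isomorphic. -/
lemma isConflation_comp_iso (h : 𝓑.Realizes x y δ) {Z' : C} (c : Z ≅ Z') :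
    𝓑.IsConflation x (y ≫ c.hom) := by
  obtain ⟨B', x', y', h'⟩ := 𝓑.exists_realization (𝓑.pull c.inv δ)
  obtain ⟨b, hx, hy⟩ := 𝓑.exists_middle (𝟙 A) c.hom h h'
    (by rw [push_id, ← pull_comp, Iso.hom_inv_id, pull_id])
  obtain ⟨b', hx', hy'⟩ := 𝓑.exists_middle (𝟙 A) c.inv h' h (by rw [push_id])
  rw [Category.id_comp] at hx hx'
  have i1 : IsIso (b ≫ b') := h.isIso_of_endo (by rw [← Category.assoc, hx, hx'])
    (by rw [Category.assoc, ← hy', ← Category.assoc, ← hy]; simp)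
  have i2 : IsIso (b' ≫ b) := h'.isIso_of_endo (by rw [← Category.assoc, hx', hx])
    (by rw [Category.assoc, ← hy, ← Category.assoc, ← hy']; simp)
  have : IsSplitMono b := IsSplitMono.mk' ⟨b' ≫ inv (b ≫ b'), by simp [← Category.assoc]⟩
  have : Epi b := epi_of_epi b' b
  have : IsIso b := isIso_of_epi_of_isSplitMono b
  refine ⟨_, 𝓑.realizes_of_iso (asIso b).symm ?_ ?_ h'⟩
  · simp [← hx]
  · simp [hy]

lemma isConflation_iso_comp (h : 𝓑.Realizes x y δ) {A' : C} (a : A' ≅ A) :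
    𝓑.IsConflation (a.hom ≫ x) y := by
  obtain ⟨B', x', y', h'⟩ := 𝓑.exists_realization (𝓑.push a.inv δ)
  obtain ⟨b, hx, hy⟩ := 𝓑.exists_middle a.inv (𝟙 Z) h h' (by rw [pull_id])
  obtain ⟨b', hx', hy'⟩ := 𝓑.exists_middle a.hom (𝟙 Z) h' h
    (by rw [pull_id, ← push_comp, Iso.inv_hom_id, push_id])
  rw [Category.comp_id] at hy hy'
  have i1 : IsIso (b ≫ b') := h.isIso_of_endo
    (by rw [← Category.assoc, hx, Category.assoc, hx']; simp) (by rw [Category.assoc, ← hy', ← hy])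
  have i2 : IsIso (b' ≫ b) := h'.isIso_of_endo
    (by rw [← Category.assoc, hx', Category.assoc, hx]; simp) (by rw [Category.assoc, ← hy, ← hy'])
  have : IsSplitMono b := IsSplitMono.mk' ⟨b' ≫ inv (b ≫ b'), by simp [← Category.assoc]⟩
  have : Epi b := epi_of_epi b' b
  have : IsIso b := isIso_of_epi_of_isSplitMono b
  refine ⟨_, 𝓑.realizes_of_iso (asIso b).symm ?_ ?_ h'⟩
  · simp only [asIso_inv, Iso.symm_hom, IsIso.comp_inv_eq, Category.assoc, hx]
    simp
  · simp [hy]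

end

/-- If `M` realizes the pullback of `δ₁` along a deflation, then the kernel of that deflation is
also the kernel of a deflation from `M` to the middle term of `δ₁`. -/
lemma exists_conflation_of_pull {A₁ A₂ B₁ B₂ Z M : C} {x₁ : A₁ ⟶ B₁} {y₁ : B₁ ⟶ Z}
    {δ₁ : 𝓑.Ext Z A₁} (h₁ : 𝓑.Realizes x₁ y₁ δ₁) {x₂ : A₂ ⟶ B₂} {y₂ : B₂ ⟶ Z} {δ₂ : 𝓑.Ext Z A₂}
    (h₂ : 𝓑.Realizes x₂ y₂ δ₂) {m : A₁ ⟶ M} {e : M ⟶ B₂}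
    (hM : 𝓑.Realizes m e (𝓑.pull y₂ δ₁)) :
    ∃ (j : A₂ ⟶ M) (p : M ⟶ B₁), 𝓑.IsConflation j p := by
  obtain ⟨G, d, e', h', δ'', -, -, hR, hS, hE, hP⟩ := 𝓑.et4_op hM h₂
  have hde := hS.comp_eq_zero
  rw [← pull_comp, h₂.comp_eq_zero, ← sub_self (0 : A₂ ⟶ Z), sub_pull, sub_self] at hS
  obtain ⟨r, s, h1, h2, h3, h4⟩ := hS.exists_split
  -- `G` splits as `A₁ ⊕ A₂`, but `r` need not carry `δ''` to `δ₁`. The two classes agree after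
  -- pullback along `y₂`, so they differ by `k_* δ₂`; replacing `r` by `r - e' ≫ k` corrects this.
  obtain ⟨k, hk⟩ := h₂.exists_push_eq (ε := 𝓑.push r δ'' - δ₁) (by
    rw [pull_sub, ← push_pull, ← hP, ← push_comp, h1, push_id, sub_self])
  have key : 𝓑.Realizes (s + k ≫ d) (r - e' ≫ k) 0 := by
    refine realizes_of_split (r := e') (s := d) ?_ ?_ ?_ hde ?_
    · simp [h2, hde]
    · simp [h1, reassoc_of% hde]
    · simp [h1, h3, reassoc_of% h2, reassoc_of% hde]
    · rw [← h4]; simp only [Preadditive.comp_add, Preadditive.sub_comp, Category.assoc]; abel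
  obtain ⟨G', d2, e2, h2', δ3, -, -, hc, hd, -, -⟩ := 𝓑.et4 key hR
  rw [sub_push, push_comp, hE, hk, sub_sub_cancel] at hd
  obtain ⟨b, -, -⟩ := 𝓑.realization_unique hd h₁
  exact ⟨_, _, hc.isConflation_comp_iso b⟩

/-- If `M` realizes the pushout of `δ₁` along an inflation, then the cokernel of that inflation is
also the cokernel of an inflation from the middle term of `δ₁` to `M`. -/
lemma exists_conflation_of_push {A B₁ B₂ Z₁ Z₂ M : C} {x₁ : A ⟶ B₁} {y₁ : B₁ ⟶ Z₁}
    {δ₁ : 𝓑.Ext Z₁ A} (h₁ : 𝓑.Realizes x₁ y₁ δ₁) {x₂ : A ⟶ B₂} {y₂ : B₂ ⟶ Z₂} {δ₂ : 𝓑.Ext Z₂ A}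
    (h₂ : 𝓑.Realizes x₂ y₂ δ₂) {m : B₂ ⟶ M} {e : M ⟶ Z₁}
    (hM : 𝓑.Realizes m e (𝓑.push x₂ δ₁)) :
    ∃ (j : B₁ ⟶ M) (p : M ⟶ Z₂), 𝓑.IsConflation j p := by
  obtain ⟨G, d, e', h', δ'', -, -, hR, hS, hE, hP⟩ := 𝓑.et4 h₂ hM
  have hde := hS.comp_eq_zero
  rw [← push_comp, h₂.comp_eq_zero, ← sub_self (0 : A ⟶ Z₂), sub_push, sub_self] at hS
  obtain ⟨r, s, h1, h2, h3, h4⟩ := hS.exists_split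
  obtain ⟨k, hk⟩ := h₂.exists_pull_eq (ε := 𝓑.pull s δ'' - δ₁) (by
    rw [push_sub, push_pull, hP, ← pull_comp, h2, pull_id, sub_self])
  have key : 𝓑.Realizes (s - k ≫ d) (r + e' ≫ k) 0 := by
    refine realizes_of_split (r := e') (s := d) ?_ ?_ ?_ hde ?_
    · simp [h2, hde]
    · simp [h1, reassoc_of% hde]
    · simp [h1, h3, reassoc_of% h2, reassoc_of% hde]
    · rw [← h4]; simp only [Preadditive.comp_sub, Preadditive.add_comp, Category.assoc]; abel
  obtain ⟨G', d2, e2, h2', δ3, -, -, hc, hd, -, -⟩ := 𝓑.et4_op hR key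
  rw [sub_pull, pull_comp, hE, hk, sub_sub_cancel] at hd
  obtain ⟨b, -, -⟩ := 𝓑.realization_unique h₁ hd
  exact ⟨_, _, hc.isConflation_iso_comp b⟩

/-- Horseshoe lemma for deflations. -/
lemma horseshoe_deflation {X Y Z A B A' B' : C} {x : X ⟶ Y} {y : Y ⟶ Z} {δ : 𝓑.Ext Z X}
    (h : 𝓑.Realizes x y δ) {a : A ⟶ B} {b : B ⟶ X} {α : 𝓑.Ext X A} (hX : 𝓑.Realizes a b α)
    {a' : A' ⟶ B'} {b' : B' ⟶ Z} {α' : 𝓑.Ext Z A'} (hZ : 𝓑.Realizes a' b' α')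
    {ε : 𝓑.Ext B' B} (hε : 𝓑.push b ε = 𝓑.pull b' δ) :
    ∃ (M N : C) (u : B ⟶ N) (v : N ⟶ B') (i : M ⟶ N) (p : N ⟶ Y) (d : A ⟶ M) (e : M ⟶ A'),
      𝓑.Realizes u v ε ∧ 𝓑.IsConflation i p ∧ 𝓑.IsConflation d e := by
  obtain ⟨N, u, v, hN⟩ := 𝓑.exists_realization ε
  obtain ⟨G, d, e, h', δ'', -, -, h1, h2, -, -⟩ := 𝓑.et4 hX hN
  rw [hε] at h2
  -- `G`, the cokernel of `A ⟶ N`, realizes the pullback of `δ` along `b'`, so it also maps onto `Y`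
  -- with kernel `A'`.
  obtain ⟨j, p, _, hjp⟩ := exists_conflation_of_pull h hZ h2
  obtain ⟨M, d', e', i, _, -, -, h3, h4, -, -⟩ := 𝓑.et4_op h1 hjp
  exact ⟨M, N, u, v, i, h' ≫ p, d', e', hN, h3.isConflation, h4.isConflation⟩

/-- Horseshoe lemma for inflations. -/
lemma horseshoe_inflation {X Y Z A B A' B' : C} {x : X ⟶ Y} {y : Y ⟶ Z} {δ : 𝓑.Ext Z X}
    (h : 𝓑.Realizes x y δ) {a : X ⟶ B} {b : B ⟶ A} {α : 𝓑.Ext A X} (hX : 𝓑.Realizes a b α)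
    {a' : Z ⟶ B'} {b' : B' ⟶ A'} {α' : 𝓑.Ext A' Z} (hZ : 𝓑.Realizes a' b' α')
    {ε : 𝓑.Ext B' B} (hε : 𝓑.pull a' ε = 𝓑.push a δ) :
    ∃ (M N : C) (u : B ⟶ N) (v : N ⟶ B') (i : Y ⟶ N) (p : N ⟶ M) (d : A ⟶ M) (e : M ⟶ A'),
      𝓑.Realizes u v ε ∧ 𝓑.IsConflation i p ∧ 𝓑.IsConflation d e := by
  obtain ⟨N, u, v, hN⟩ := 𝓑.exists_realization ε
  obtain ⟨G, d, e, h', δ'', -, -, h1, h2, -, -⟩ := 𝓑.et4_op hN hZ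
  rw [hε] at h2
  obtain ⟨j, p, _, hjp⟩ := exists_conflation_of_push h hX h2
  obtain ⟨M, d', e', i, _, -, -, h3, h4, -, -⟩ := 𝓑.et4 hjp h1
  exact ⟨M, N, u, v, j ≫ h', i, d', e', hN, h3.isConflation, h4.isConflation⟩

/-- The kernel of `U ⟶ Z ⟶ X`, for a retract `X` of `Z`, is a retract of `V ⊞ U`, where `V` is the
kernel of `U ⟶ Z`. -/
lemma nonempty_retract_kernel {V U Z X W : C} {x : V ⟶ U} {y : U ⟶ Z} {δ : 𝓑.Ext Z V}
    (h : 𝓑.Realizes x y δ) (r : Retract X Z) {t : W ⟶ U} {δX : 𝓑.Ext X W}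
    (hX : 𝓑.Realizes t (y ≫ r.r) δX) (hUV : Subsingleton (𝓑.Ext U V)) :
    Nonempty (Retract W (V ⊞ U)) := by
  obtain ⟨a, -, ha⟩ := 𝓑.et3_op (b := 𝟙 U) (c := r.r) h hX (by simp)
  obtain ⟨b, hb⟩ := h.exists_lift (c := (y ≫ r.r) ≫ r.i) (Subsingleton.elim _ _)
  obtain ⟨a', -, ha'⟩ := 𝓑.et3_op (b := b) (c := r.i) hX h hb.symm
  -- `a' ≫ a` fixes `δX`, so its difference from the identity factors through `t`.
  obtain ⟨u, hu⟩ := hX.exists_extend (a := 𝟙 W - a' ≫ a) (by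
    rw [sub_push, push_id, push_comp, ha', push_pull, ha, ← pull_comp, r.retract, pull_id,
      sub_self])
  exact ⟨⟨biprod.lift a' t, biprod.desc a u, by simp [hu]⟩⟩

/-- The cokernel of `X ⟶ Z ⟶ V`, for a retract `X` of `Z`, is a retract of `U ⊞ V`, where `U` is
the cokernel of `Z ⟶ V`. -/
lemma nonempty_retract_cokernel {V U Z X W : C} {x : Z ⟶ V} {y : V ⟶ U} {δ : 𝓑.Ext U Z}
    (h : 𝓑.Realizes x y δ) (r : Retract X Z) {t : V ⟶ W} {δX : 𝓑.Ext W X}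
    (hX : 𝓑.Realizes (r.i ≫ x) t δX) (hUV : Subsingleton (𝓑.Ext U V)) :
    Nonempty (Retract W (U ⊞ V)) := by
  obtain ⟨a, -, ha⟩ := 𝓑.et3 (a := r.i) (b := 𝟙 V) hX h (by simp)
  obtain ⟨b, hb⟩ := h.exists_extend (a := r.r ≫ r.i ≫ x) (Subsingleton.elim _ _)
  obtain ⟨a', -, ha'⟩ := 𝓑.et3 (a := r.r) (b := b) h hX hb
  obtain ⟨u, hu⟩ := hX.exists_lift (c := 𝟙 W - a ≫ a') (by
    rw [sub_pull, pull_id, pull_comp, ← ha', ← push_pull, ← ha, ← push_comp, r.retract, push_id,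
      sub_self])
  exact ⟨⟨biprod.lift a u, biprod.desc a' t, by simp [hu]⟩⟩

end Realizes

end Extriangulation

/-! ### Vanishing of extensions in `𝔼`-triangles and dimension shifting. -/

namespace Extriangulation

open ExtensionBifunctor

variable {C : Type u} [Category.{v} C] [Preadditive C] [HasZeroObject C] [HasBinaryBiproducts C]
  {𝓑 : Extriangulation.{w} C}

lemma isConflation_id (A : C) {Z : C} (hZ : IsZero Z) : 𝓑.IsConflation (𝟙 A) (0 : A ⟶ Z) :=
  ⟨_, realizes_id A hZ⟩

lemma isConflation_id' (Z : C) {A : C} (hA : IsZero A) : 𝓑.IsConflation (0 : A ⟶ Z) (𝟙 Z) :=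
  ⟨_, realizes_id' Z hA⟩

lemma projectives.subsingleton_ext {P : C} (hP : 𝓑.projectives P) (A : C) :
    Subsingleton (𝓑.Ext P A) := by
  refine subsingleton_of_forall_eq 0 fun δ => ?_
  obtain ⟨B, x, y, h⟩ := 𝓑.exists_realization δ
  obtain ⟨s, hs⟩ := hP x y h.isConflation (𝟙 P)
  rw [← 𝓑.pull_id δ, ← hs, pull_comp, h.pull_eq_zero, pull_zero]

lemma injectives.subsingleton_ext {I : C} (hI : 𝓑.injectives I) (Z : C) :
    Subsingleton (𝓑.Ext Z I) := by
  refine subsingleton_of_forall_eq 0 fun δ => ?_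
  obtain ⟨B, x, y, h⟩ := 𝓑.exists_realization δ
  obtain ⟨s, hs⟩ := hI x y h.isConflation (𝟙 I)
  rw [← 𝓑.push_id δ, ← hs, push_comp, h.push_eq_zero, push_zero]

lemma projectives_of_subsingleton_ext {P : C} (h : ∀ A : C, Subsingleton (𝓑.Ext P A)) :
    𝓑.projectives P := fun _ _ ⟨_, hδ⟩ _ =>
  hδ.exists_lift ((h _).elim _ _)

section Vanishing

variable {A B Z : C} {x : A ⟶ B} {y : B ⟶ Z}

lemma IsConflation.ext_middle_left (h : 𝓑.IsConflation x y) {T : C}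
    (hA : Subsingleton (𝓑.Ext A T)) (hZ : Subsingleton (𝓑.Ext Z T)) :
    Subsingleton (𝓑.Ext B T) := by
  obtain ⟨δ, h⟩ := h
  refine subsingleton_of_forall_eq 0 fun ε => ?_
  obtain ⟨ε', rfl⟩ := h.exists_pull_right_eq (ε := ε) (hA.elim _ _)
  rw [hZ.elim ε' 0, pull_zero]

/-- This is exactness of `𝔼(W, B) ⟶ 𝔼(W, Z) ⟶ 𝔼²(W, A)` when the last group vanishes: `ε` comes from
a map `K ⟶ Z`, and the obstruction to lifting it to `B` lies in `𝔼(K, A)`. -/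
lemma IsConflation.exists_push_eq (h : 𝓑.IsConflation x y) {K P W : C} {i : K ⟶ P} {p : P ⟶ W}
    (hp : 𝓑.IsConflation i p) (hP : 𝓑.projectives P) (hK : Subsingleton (𝓑.Ext K A))
    (ε : 𝓑.Ext W Z) : ∃ ε' : 𝓑.Ext W B, 𝓑.push y ε' = ε := by
  obtain ⟨δ, h⟩ := h
  obtain ⟨θ, hp⟩ := hp
  obtain ⟨f, rfl⟩ := hp.exists_push_eq (ε := ε) ((hP.subsingleton_ext _).elim _ _)
  obtain ⟨g, rfl⟩ := h.exists_lift (c := f) (hK.elim _ _)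
  exact ⟨𝓑.push g θ, by rw [push_comp]⟩

lemma IsConflation.ext_right_right (h : 𝓑.IsConflation x y) {K P W : C} {i : K ⟶ P} {p : P ⟶ W}
    (hp : 𝓑.IsConflation i p) (hP : 𝓑.projectives P) (hK : Subsingleton (𝓑.Ext K A))
    (hB : Subsingleton (𝓑.Ext W B)) : Subsingleton (𝓑.Ext W Z) := by
  refine subsingleton_of_forall_eq 0 fun ε => ?_
  obtain ⟨ε', rfl⟩ := h.exists_push_eq hp hP hK ε
  rw [hB.elim ε' 0, push_zero]

lemma IsConflation.ext_left_left (h : 𝓑.IsConflation x y) {T I T' : C} {i : T ⟶ I} {p : I ⟶ T'}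
    (hp : 𝓑.IsConflation i p) (hI : 𝓑.injectives I) (hT : Subsingleton (𝓑.Ext Z T'))
    (hB : Subsingleton (𝓑.Ext B T)) : Subsingleton (𝓑.Ext A T) := by
  refine subsingleton_of_forall_eq 0 fun ε => ?_
  obtain ⟨δ, h⟩ := h
  obtain ⟨θ, hp⟩ := hp
  obtain ⟨f, rfl⟩ := hp.exists_pull_eq (ε := ε) ((hI.subsingleton_ext _).elim _ _)
  obtain ⟨g, rfl⟩ := h.exists_extend (a := f) (hT.elim _ _)
  rw [pull_comp, hB.elim (𝓑.pull g θ) 0, pull_zero]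

lemma IsConflation.ext_right_left (h : 𝓑.IsConflation x y) {T I T' : C} {i : T ⟶ I} {p : I ⟶ T'}
    (hp : 𝓑.IsConflation i p) (hI : 𝓑.injectives I) (hA : Subsingleton (𝓑.Ext A T))
    (hB : Subsingleton (𝓑.Ext B T')) : Subsingleton (𝓑.Ext Z T') := by
  refine subsingleton_of_forall_eq 0 fun ε => ?_
  obtain ⟨δ, h⟩ := h
  obtain ⟨θ, hp⟩ := hp
  obtain ⟨f, rfl⟩ := h.exists_push_eq (ε := ε) (hB.elim _ _)
  obtain ⟨g, rfl⟩ := hp.exists_lift (c := f) (hA.elim _ _)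
  rw [push_comp, (hI.subsingleton_ext _).elim (𝓑.push g δ) 0, push_zero]

end Vanishing

section HigherExtensions

variable (𝓑) in
lemma exists_conflation_syzygy [𝓑.HasEnoughProjectives] (X : C) :
    ∃ (P : C) (x : 𝓑.syzygy X ⟶ P) (y : P ⟶ X), 𝓑.projectives P ∧ 𝓑.IsConflation x y :=
  (‹𝓑.HasEnoughProjectives›.exists_conflation X).choose_spec

variable (𝓑) in
/-- A chosen cosyzygy of `Y`. -/
noncomputable def cosyzygy [𝓑.HasEnoughInjectives] (Y : C) : C :=
  (‹𝓑.HasEnoughInjectives›.exists_conflation Y).choose_spec.choose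

variable (𝓑) in
lemma exists_conflation_cosyzygy [𝓑.HasEnoughInjectives] (Y : C) :
    ∃ (I : C) (x : Y ⟶ I) (y : I ⟶ 𝓑.cosyzygy Y), 𝓑.injectives I ∧ 𝓑.IsConflation x y :=
  ⟨_, (‹𝓑.HasEnoughInjectives›.exists_conflation Y).choose_spec.choose_spec⟩

variable [𝓑.HasEnoughProjectives] [𝓑.HasEnoughInjectives]

lemma subsingleton_ext_syzygy_iff (X Y : C) :
    Subsingleton (𝓑.Ext (𝓑.syzygy X) Y) ↔ Subsingleton (𝓑.Ext X (𝓑.cosyzygy Y)) := by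
  obtain ⟨P, i, p, hP, hp⟩ := 𝓑.exists_conflation_syzygy X
  obtain ⟨I, j, q, hI, hq⟩ := 𝓑.exists_conflation_cosyzygy Y
  exact ⟨fun h => hq.ext_right_right hp hP h (hI.subsingleton_ext _),
    fun h => hp.ext_left_left hq hI h (hP.subsingleton_ext _)⟩

/-- Moving the shift to the second argument leaves the first one untouched, so vanishing along a
triangle in the first variable needs no syzygies of that triangle. -/
lemma subsingleton_extSucc_iff (i : ℕ) (X Y : C) :
    Subsingleton (𝓑.ExtSucc i X Y) ↔ Subsingleton (𝓑.Ext X (𝓑.cosyzygy^[i] Y)) := by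
  induction i generalizing Y with
  | zero => exact Iff.rfl
  | succ i ih =>
    rw [Function.iterate_succ_apply, ← ih]
    exact subsingleton_ext_syzygy_iff _ _

lemma subsingleton_extSucc_of_projectives {P : C} (hP : 𝓑.projectives P) (i : ℕ) (Y : C) :
    Subsingleton (𝓑.ExtSucc i P Y) :=
  (subsingleton_extSucc_iff _ _ _).2 (hP.subsingleton_ext _)

lemma subsingleton_extSucc_of_retract {X Z : C} (r : Retract X Z) {i : ℕ} {Y : C}
    (h : Subsingleton (𝓑.ExtSucc i Z Y)) : Subsingleton (𝓑.ExtSucc i X Y) := by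
  rw [subsingleton_extSucc_iff] at h ⊢
  exact 𝓑.subsingleton_of_retract r h

namespace IsConflation

variable {A B Z : C} {x : A ⟶ B} {y : B ⟶ Z}

lemma extSucc_middle_left (h : 𝓑.IsConflation x y) {i : ℕ} {T : C}
    (hA : Subsingleton (𝓑.ExtSucc i A T)) (hZ : Subsingleton (𝓑.ExtSucc i Z T)) :
    Subsingleton (𝓑.ExtSucc i B T) := by
  rw [subsingleton_extSucc_iff] at *
  exact h.ext_middle_left hA hZ

lemma extSucc_left_left (h : 𝓑.IsConflation x y) {i : ℕ} {T : C}
    (hB : Subsingleton (𝓑.ExtSucc i B T)) (hZ : Subsingleton (𝓑.ExtSucc (i + 1) Z T)) :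
    Subsingleton (𝓑.ExtSucc i A T) := by
  rw [subsingleton_extSucc_iff] at *
  rw [Function.iterate_succ_apply'] at hZ
  obtain ⟨I, j, q, hI, hq⟩ := 𝓑.exists_conflation_cosyzygy (𝓑.cosyzygy^[i] T)
  exact h.ext_left_left hq hI hZ hB

lemma extSucc_right_left (h : 𝓑.IsConflation x y) {i : ℕ} {T : C}
    (hA : Subsingleton (𝓑.ExtSucc i A T)) (hB : Subsingleton (𝓑.ExtSucc (i + 1) B T)) :
    Subsingleton (𝓑.ExtSucc (i + 1) Z T) := by
  rw [subsingleton_extSucc_iff] at *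
  rw [Function.iterate_succ_apply'] at *
  obtain ⟨I, j, q, hI, hq⟩ := 𝓑.exists_conflation_cosyzygy (𝓑.cosyzygy^[i] T)
  exact h.ext_right_left hq hI hA hB

omit [𝓑.HasEnoughInjectives] in
lemma extSucc_right_right (h : 𝓑.IsConflation x y) {i : ℕ} {W : C}
    (hB : Subsingleton (𝓑.ExtSucc i W B)) (hA : Subsingleton (𝓑.ExtSucc (i + 1) W A)) :
    Subsingleton (𝓑.ExtSucc i W Z) := by
  obtain ⟨P, j, p, hP, hp⟩ := 𝓑.exists_conflation_syzygy (𝓑.iterSyzygy i W)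
  exact h.ext_right_right hp hP hA hB

end IsConflation

end HigherExtensions

/-! ### Retracts under (WIC), and composites of conflations. -/

section Retracts

/-- A retract in a category satisfying (WIC) is a direct summand. -/
lemma WIC.exists_iso_biprod (wic : 𝓑.WIC) {X Z : C} (r : Retract X Z) :
    ∃ Y : C, Nonempty (X ⊞ Y ≅ Z) := by
  obtain ⟨Y, y, δ, h⟩ := (wic r.i r.r).1 (by
    rw [r.retract]; exact ⟨_, 0, isConflation_id X (isZero_zero C)⟩)
  have hδ : δ = 0 := by
    rw [← 𝓑.push_id δ, ← r.retract, push_comp, h.push_eq_zero, push_zero]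
  subst hδ
  exact ⟨Y, h.nonempty_iso_biprod⟩

lemma WIC.isInflation_retract (wic : 𝓑.WIC) {X Z : C} (r : Retract X Z) : 𝓑.IsInflation r.i :=
  (wic r.i r.r).1 (by rw [r.retract]; exact ⟨_, 0, isConflation_id X (isZero_zero C)⟩)

lemma WIC.isDeflation_retract (wic : 𝓑.WIC) {X Z : C} (r : Retract X Z) : 𝓑.IsDeflation r.r :=
  (wic r.i r.r).2 (by rw [r.retract]; exact ⟨_, 0, isConflation_id' X (isZero_zero C)⟩)

lemma _root_.IsSummandClosedSubcategory.of_retract {S : ObjectProperty C}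
    (hS : IsSummandClosedSubcategory S) (wic : 𝓑.WIC) {X Z : C} (r : Retract X Z) (hZ : S Z) :
    S X := by
  obtain ⟨Y, ⟨e⟩⟩ := wic.exists_iso_biprod r
  exact hS.summand (hS.of_iso e.symm hZ)

lemma isSummandClosedSubcategory_of_retract {S : ObjectProperty C}
    (h0 : ∀ {X : C}, IsZero X → S X)
    (hret : ∀ {X Z : C}, Retract X Z → S Z → S X)
    (hext : ∀ {A B Z : C} (x : A ⟶ B) (y : B ⟶ Z), 𝓑.IsConflation x y → S A → S Z → S B) :
    IsSummandClosedSubcategory S where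
  of_iso e h := hret (Retract.ofIso e.symm) h
  zero h := h0 h
  sum hX hY := hext _ _ ⟨_, 𝓑.realizes_zero _ _⟩ hX hY
  summand h := hret ⟨biprod.inl, biprod.fst, by simp⟩ h

lemma IsInflation.comp {A B Z : C} {x : A ⟶ B} {y : B ⟶ Z} (hx : 𝓑.IsInflation x)
    (hy : 𝓑.IsInflation y) : 𝓑.IsInflation (x ≫ y) := by
  obtain ⟨D, x', δ, hx⟩ := hx
  obtain ⟨F, y', δ', hy⟩ := hy
  obtain ⟨G, _, _, h', _, -, -, h, -⟩ := 𝓑.et4 hx hy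
  exact ⟨G, h', h.isConflation⟩

lemma IsDeflation.comp {A B Z : C} {x : A ⟶ B} {y : B ⟶ Z} (hx : 𝓑.IsDeflation x)
    (hy : 𝓑.IsDeflation y) : 𝓑.IsDeflation (x ≫ y) := by
  obtain ⟨D, x', δ, hx⟩ := hx
  obtain ⟨F, y', δ', hy⟩ := hy
  obtain ⟨G, _, _, h', _, -, -, h, -⟩ := 𝓑.et4_op hx hy
  exact ⟨G, h', h.isConflation⟩

lemma IsConflation.comp_inflation {A B D Z F : C} {f : A ⟶ B} {f' : B ⟶ D} {g : B ⟶ Z}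
    {g' : Z ⟶ F} (hf : 𝓑.IsConflation f f') (hg : 𝓑.IsConflation g g') :
    ∃ (G : C) (h : A ⟶ Z) (h' : Z ⟶ G) (d : D ⟶ G) (e : G ⟶ F),
      𝓑.IsConflation h h' ∧ 𝓑.IsConflation d e := by
  obtain ⟨δ, hf⟩ := hf
  obtain ⟨δ', hg⟩ := hg
  obtain ⟨G, d, e, h', _, -, -, h1, h2, -⟩ := 𝓑.et4 hf hg
  exact ⟨G, _, h', d, e, h1.isConflation, h2.isConflation⟩

lemma IsConflation.comp_deflation {A B D Z F : C} {f' : D ⟶ A} {f : A ⟶ B} {g' : F ⟶ B}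
    {g : B ⟶ Z} (hf : 𝓑.IsConflation f' f) (hg : 𝓑.IsConflation g' g) :
    ∃ (G : C) (h' : G ⟶ A) (h : A ⟶ Z) (d : D ⟶ G) (e : G ⟶ F),
      𝓑.IsConflation h' h ∧ 𝓑.IsConflation d e := by
  obtain ⟨δ, hf⟩ := hf
  obtain ⟨δ', hg⟩ := hg
  obtain ⟨G, d, e, h', _, -, -, h1, h2, -⟩ := 𝓑.et4_op hf hg
  exact ⟨G, h', _, d, e, h1.isConflation, h2.isConflation⟩

end Retracts

/-! ### Finite `S`-resolutions and coresolutions, and the thick subcategory they generate. -/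

section Resolutions

variable (𝓑) in
/-- `Cone(S, T)`. -/
def cone (S T : ObjectProperty C) : ObjectProperty C := fun X =>
  ∃ (A B : C) (x : A ⟶ B) (y : B ⟶ X), S A ∧ T B ∧ 𝓑.IsConflation x y

variable (𝓑) in
/-- `S^∧_n`: the objects with an `S`-resolution of length at most `n`. -/
def wedge (S : ObjectProperty C) : ℕ → ObjectProperty C
  | 0 => S
  | n + 1 => 𝓑.cone (wedge S n) S

variable (𝓑) in
/-- `S^∨`: the objects with a finite `S`-coresolution. -/
def finVee (S : ObjectProperty C) : ObjectProperty C := fun X => ∃ n, 𝓑.vee S n X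

variable (𝓑) in
/-- `S^∧`: the objects with a finite `S`-resolution. -/
def finWedge (S : ObjectProperty C) : ObjectProperty C := fun X => ∃ n, 𝓑.wedge S n X

variable {S : ObjectProperty C}

lemma vee_le_succ (hS : IsSummandClosedSubcategory S) (n : ℕ) :
    𝓑.vee S n ≤ 𝓑.vee S (n + 1) := by
  induction n with
  | zero =>
    exact fun X hX => ⟨X, _, _, _, hX, hS.zero (isZero_zero C),
      isConflation_id X (isZero_zero C)⟩
  | succ n ih =>
    rintro X ⟨A, B, x, y, hA, hB, h⟩
    exact ⟨A, B, x, y, hA, ih _ hB, h⟩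

lemma wedge_le_succ (hS : IsSummandClosedSubcategory S) (n : ℕ) :
    𝓑.wedge S n ≤ 𝓑.wedge S (n + 1) := by
  induction n with
  | zero =>
    exact fun X hX => ⟨_, X, _, _, hS.zero (isZero_zero C), hX,
      isConflation_id' X (isZero_zero C)⟩
  | succ n ih =>
    rintro X ⟨A, B, x, y, hA, hB, h⟩
    exact ⟨A, B, x, y, ih _ hA, hB, h⟩

lemma monotone_vee (hS : IsSummandClosedSubcategory S) : Monotone (𝓑.vee S) :=
  monotone_nat_of_le_succ (vee_le_succ hS)

lemma monotone_wedge (hS : IsSummandClosedSubcategory S) : Monotone (𝓑.wedge S) :=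
  monotone_nat_of_le_succ (wedge_le_succ hS)

lemma vee_le_thick (n : ℕ) : 𝓑.vee S n ≤ 𝓑.thick S := by
  induction n with
  | zero => exact fun X hX T _ hT => hT _ hX
  | succ n ih =>
    rintro X ⟨A, B, x, y, hA, hB, h⟩ T hT hST
    exact hT.left x y h (hST _ hA) (ih _ hB T hT hST)

variable [𝓑.HasEnoughProjectives]

namespace IsPresilting

variable (hS : 𝓑.IsPresilting S)
include hS

lemma subsingleton_ext {X Y : C} (hX : S X) (hY : S Y) : Subsingleton (𝓑.Ext X Y) :=
  hS.ext_vanish 0 X Y hX hY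

omit hS in
lemma extSucc_finWedge {X : C} (hX : ∀ (i : ℕ) (Y : C), S Y → Subsingleton (𝓑.ExtSucc i X Y))
    {Y : C} (hY : 𝓑.finWedge S Y) (i : ℕ) : Subsingleton (𝓑.ExtSucc i X Y) := by
  obtain ⟨n, hY⟩ := hY
  induction n generalizing Y i with
  | zero => exact hX i Y hY
  | succ n ih =>
    obtain ⟨A, B, x, y, hA, hB, h⟩ := hY
    exact h.extSucc_right_right (hX i B hB) (ih _ hA)

section

variable [𝓑.HasEnoughInjectives]

lemma extSucc_finVee {X : C} (hX : 𝓑.finVee S X) (i : ℕ) (Y : C) (hY : S Y) :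
    Subsingleton (𝓑.ExtSucc i X Y) := by
  obtain ⟨n, hX⟩ := hX
  induction n generalizing X i with
  | zero => exact hS.ext_vanish i X Y hX hY
  | succ n ih =>
    obtain ⟨A, B, x, y, hA, hB, h⟩ := hX
    exact h.extSucc_left_left (hS.ext_vanish i A Y hA hY) (ih _ hB)

lemma extSucc_finVee_finWedge {X Y : C} (hX : 𝓑.finVee S X) (hY : 𝓑.finWedge S Y) (i : ℕ) :
    Subsingleton (𝓑.ExtSucc i X Y) :=
  extSucc_finWedge (hS.extSucc_finVee hX) hY i

end

lemma of_realizes {A B Z : C} {x : A ⟶ B} {y : B ⟶ Z} {δ : 𝓑.Ext Z A} (h : 𝓑.Realizes x y δ)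
    (hA : S A) (hZ : S Z) : S B := by
  rw [(hS.subsingleton_ext hZ hA).elim δ 0] at h
  obtain ⟨e⟩ := h.nonempty_iso_biprod
  exact hS.isSubcategory.of_iso e (hS.isSubcategory.sum hA hZ)

/-- The last deflation `B ⟶ X` of the resolution splits, its kernel being in `S^∧`, where extensions
from `X` vanish. -/
lemma of_finWedge (wic : 𝓑.WIC) {X : C}
    (hX : ∀ (i : ℕ) (Y : C), S Y → Subsingleton (𝓑.ExtSucc i X Y))
    (hX' : 𝓑.finWedge S X) : S X := by
  obtain ⟨_ | n, hX'⟩ := hX'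
  · exact hX'
  · obtain ⟨A, B, x, y, hA, hB, δ, h⟩ := hX'
    have := extSucc_finWedge hX ⟨n, hA⟩ 0
    obtain ⟨s, hs⟩ := h.exists_lift (c := 𝟙 X) (this.elim _ _)
    exact hS.isSubcategory.of_retract wic ⟨s, y, hs⟩ hB

variable [𝓑.HasEnoughInjectives]

lemma vee_of_isConflation (n : ℕ) {X Y Z : C} {x : X ⟶ Y} {y : Y ⟶ Z} (h : 𝓑.IsConflation x y)
    (hX : 𝓑.vee S n X) (hZ : 𝓑.vee S n Z) : 𝓑.vee S n Y := by
  induction n generalizing X Y Z with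
  | zero =>
    obtain ⟨δ, h⟩ := h
    exact hS.of_realizes h hX hZ
  | succ n ih =>
    obtain ⟨δ, h⟩ := h
    have hZ' : 𝓑.finVee S Z := ⟨_, hZ⟩
    obtain ⟨B, A, a, b, hB, hA, α, hXc⟩ := hX
    obtain ⟨B', A', a', b', hB', hA', α', hZc⟩ := hZ
    -- The zero extension is compatible with `δ` because `𝔼(Z, B) = 0`.
    obtain ⟨M, N, u, v, i, p, d, e, hN, hi, hd⟩ := h.horseshoe_inflation hXc hZc (ε := 0) (by
      have := hS.extSucc_finVee hZ' 0 B hB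
      exact this.elim _ _)
    exact ⟨N, M, i, p, hS.of_realizes hN hB hB', ih hd hA hA', hi⟩

lemma wedge_of_isConflation (n : ℕ) {X Y Z : C} {x : X ⟶ Y} {y : Y ⟶ Z} (h : 𝓑.IsConflation x y)
    (hX : 𝓑.wedge S n X) (hZ : 𝓑.wedge S n Z) : 𝓑.wedge S n Y := by
  induction n generalizing X Y Z with
  | zero =>
    obtain ⟨δ, h⟩ := h
    exact hS.of_realizes h hX hZ
  | succ n ih =>
    obtain ⟨δ, h⟩ := h
    have hX' : 𝓑.finWedge S X := ⟨_, hX⟩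
    obtain ⟨A, B, a, b, hA, hB, α, hXc⟩ := hX
    obtain ⟨A', B', a', b', hA', hB', α', hZc⟩ := hZ
    obtain ⟨M, N, u, v, i, p, d, e, hN, hi, hd⟩ := h.horseshoe_deflation hXc hZc (ε := 0) (by
      have := hS.extSucc_finVee_finWedge ⟨0, hB'⟩ hX' 0
      exact this.elim _ _)
    exact ⟨M, N, i, p, ih hd hA hA', hS.of_realizes hN hB hB', hi⟩

lemma finVee_of_isConflation {X Y Z : C} {x : X ⟶ Y} {y : Y ⟶ Z} (h : 𝓑.IsConflation x y) :
    𝓑.finVee S X → 𝓑.finVee S Z → 𝓑.finVee S Y := by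
  rintro ⟨m, hX⟩ ⟨n, hZ⟩
  exact ⟨max m n, hS.vee_of_isConflation _ h (monotone_vee hS.isSubcategory (le_max_left m n) _ hX)
    (monotone_vee hS.isSubcategory (le_max_right m n) _ hZ)⟩

lemma finWedge_of_isConflation {X Y Z : C} {x : X ⟶ Y} {y : Y ⟶ Z} (h : 𝓑.IsConflation x y) :
    𝓑.finWedge S X → 𝓑.finWedge S Z → 𝓑.finWedge S Y := by
  rintro ⟨m, hX⟩ ⟨n, hZ⟩
  exact ⟨max m n, hS.wedge_of_isConflation _ h
    (monotone_wedge hS.isSubcategory (le_max_left m n) _ hX)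
    (monotone_wedge hS.isSubcategory (le_max_right m n) _ hZ)⟩

lemma vee_of_retract (wic : 𝓑.WIC) (n : ℕ) {X Z : C} (r : Retract X Z) (hZ : 𝓑.vee S n Z) :
    𝓑.vee S n X := by
  induction n generalizing X Z with
  | zero => exact hS.isSubcategory.of_retract wic r hZ
  | succ n ih =>
    obtain ⟨A, B, x, y, hA, hB, h⟩ := hZ
    obtain ⟨W, t, hW⟩ := (wic.isInflation_retract r).comp ⟨_, _, h⟩
    obtain ⟨δ, h⟩ := h
    obtain ⟨δ', hW'⟩ := hW
    -- The cokernel `W` of `X ⟶ Z ⟶ A` is a retract of `B ⊞ A`, which has a coresolution of length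
    -- `n`.
    obtain ⟨ρ⟩ := h.nonempty_retract_cokernel r hW' (hS.extSucc_finVee ⟨n, hB⟩ 0 A hA)
    refine ⟨A, W, _, t, hA, ih ρ ?_, hW'.isConflation⟩
    exact hS.vee_of_isConflation n ⟨_, 𝓑.realizes_zero _ _⟩ hB
      (monotone_vee hS.isSubcategory (Nat.zero_le n) _ hA)

omit [𝓑.HasEnoughInjectives] in
/-- The objects with a deflation from an object of `S^∨` with kernel in `S^∧` are the objects with
an inflation to an object of `S^∧` with cokernel in `S^∨`. -/
lemma cone_eq_coCone :
    𝓑.cone (𝓑.finWedge S) (𝓑.finVee S) = 𝓑.coCone (𝓑.finWedge S) (𝓑.finVee S) := by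
  ext X
  constructor
  · rintro ⟨V, U, x, y, ⟨m, hV⟩, ⟨n, hU⟩, h⟩
    -- Embed `U` into `A` in `S`: the cokernel of `V ⟶ U ⟶ A` lies in `S^∧` and receives `X` with
    -- cokernel `B`.
    obtain ⟨A, B, x', y', hA, hB, h'⟩ := vee_le_succ hS.isSubcategory n _ hU
    obtain ⟨G, a, b, d, e, hG, hd⟩ := h.comp_inflation h'
    exact ⟨G, B, d, e, ⟨m + 1, V, A, a, b, hV, hA, hG⟩, ⟨n, hB⟩, hd⟩
  · rintro ⟨V, U, x, y, ⟨m, hV⟩, ⟨n, hU⟩, h⟩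
    obtain ⟨A, B, x', y', hA, hB, h'⟩ := wedge_le_succ hS.isSubcategory m _ hV
    obtain ⟨G, a, b, d, e, hG, hd⟩ := h'.comp_deflation h
    exact ⟨A, G, d, e, ⟨m, hA⟩, ⟨n + 1, B, U, a, b, hB, hU, hG⟩, hd⟩

omit [𝓑.HasEnoughInjectives] in
lemma finVee_le_cone : 𝓑.finVee S ≤ 𝓑.cone (𝓑.finWedge S) (𝓑.finVee S) := fun X hX =>
  ⟨_, X, _, _, ⟨0, hS.isSubcategory.zero (isZero_zero C)⟩, hX, isConflation_id' X (isZero_zero C)⟩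

omit [𝓑.HasEnoughInjectives] in
lemma finWedge_le_cone : 𝓑.finWedge S ≤ 𝓑.cone (𝓑.finWedge S) (𝓑.finVee S) := by
  rw [hS.cone_eq_coCone]
  exact fun X hX => ⟨X, _, _, _, hX, ⟨0, hS.isSubcategory.zero (isZero_zero C)⟩,
    isConflation_id X (isZero_zero C)⟩

lemma cone_middle {X Y Z : C} {x : X ⟶ Y} {y : Y ⟶ Z} (h : 𝓑.IsConflation x y)
    (hX : 𝓑.cone (𝓑.finWedge S) (𝓑.finVee S) X) (hZ : 𝓑.cone (𝓑.finWedge S) (𝓑.finVee S) Z) :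
    𝓑.cone (𝓑.finWedge S) (𝓑.finVee S) Y := by
  obtain ⟨δ, h⟩ := h
  obtain ⟨V, U, a, b, hV, hU, hX⟩ := hX
  obtain ⟨V', U', a', b', hV', hU', α', hZ⟩ := hZ
  obtain ⟨P, j, p, hP, hp⟩ := 𝓑.exists_conflation_syzygy U'
  -- Here `ε = 0` need not be compatible with `δ`; a suitable `ε` exists because `𝔼²(U', V) = 0`.
  obtain ⟨ε, hε⟩ := hX.exists_push_eq hp hP (hS.extSucc_finVee_finWedge hU' hV 1) (𝓑.pull b' δ)
  obtain ⟨α, hX⟩ := hX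
  obtain ⟨M, N, u, v, i, q, d, e, hN, hi, hd⟩ := h.horseshoe_deflation hX hZ hε
  exact ⟨M, N, i, q, hS.finWedge_of_isConflation hd hV hV',
    hS.finVee_of_isConflation hN.isConflation hU hU', hi⟩

/-- Pushing out along `X ⟶ V` gives `M`, an extension of `U` by `Y`, hence a cone. The kernel of `U'
⟶ M ⟶ Z` is then an extension of `V` by `V'`. -/
lemma cone_right {X Y Z : C} {x : X ⟶ Y} {y : Y ⟶ Z} (h : 𝓑.IsConflation x y)
    (hX : 𝓑.cone (𝓑.finWedge S) (𝓑.finVee S) X) (hY : 𝓑.cone (𝓑.finWedge S) (𝓑.finVee S) Y) :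
    𝓑.cone (𝓑.finWedge S) (𝓑.finVee S) Z := by
  obtain ⟨δ, h⟩ := h
  rw [hS.cone_eq_coCone] at hX
  obtain ⟨V, U, a, b, hV, hU, α, hX⟩ := hX
  obtain ⟨M, m, e, hM⟩ := 𝓑.exists_realization (𝓑.push a δ)
  obtain ⟨j, p, hjp⟩ := h.exists_conflation_of_push hX hM
  obtain ⟨V', U', a', b', hV', hU', hM'⟩ := hS.cone_middle hjp hY (hS.finVee_le_cone _ hU)
  obtain ⟨G, s, t, d, e, hG, hd⟩ := hM'.comp_deflation hM.isConflation
  exact ⟨G, U', s, t, hS.finWedge_of_isConflation hd hV' hV, hU', hG⟩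

lemma cone_left {X Y Z : C} {x : X ⟶ Y} {y : Y ⟶ Z} (h : 𝓑.IsConflation x y)
    (hY : 𝓑.cone (𝓑.finWedge S) (𝓑.finVee S) Y) (hZ : 𝓑.cone (𝓑.finWedge S) (𝓑.finVee S) Z) :
    𝓑.cone (𝓑.finWedge S) (𝓑.finVee S) X := by
  obtain ⟨δ, h⟩ := h
  obtain ⟨V, U, a, b, hV, hU, α, hZ⟩ := hZ
  obtain ⟨M, m, e, hM⟩ := 𝓑.exists_realization (𝓑.pull b δ)
  obtain ⟨j, p, hjp⟩ := h.exists_conflation_of_pull hZ hM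
  have hM' := hS.cone_middle hjp (hS.finWedge_le_cone _ hV) hY
  rw [hS.cone_eq_coCone] at hM' ⊢
  obtain ⟨V', U', a', b', hV', hU', hM'⟩ := hM'
  obtain ⟨G, s, t, d, e, hG, hd⟩ := hM.isConflation.comp_inflation hM'
  exact ⟨V', G, s, t, hV', hS.finVee_of_isConflation hd hU hU', hG⟩

lemma finVee_of_cone (wic : 𝓑.WIC) {X : C} (hX : 𝓑.cone (𝓑.finWedge S) (𝓑.finVee S) X)
    (hXS : ∀ (i : ℕ) (Y : C), S Y → Subsingleton (𝓑.ExtSucc i X Y)) : 𝓑.finVee S X := by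
  rw [hS.cone_eq_coCone] at hX
  obtain ⟨V, U, x, y, hV, ⟨n, hU⟩, h⟩ := hX
  exact ⟨n + 1, V, U, x, y, hS.of_finWedge wic (fun i Y hY =>
    h.extSucc_middle_left (hXS i Y hY) (hS.extSucc_finVee ⟨n, hU⟩ i Y hY)) hV, hU, h⟩

/-- Induction on the degree `d` above which extensions from `Z` to `S` vanish. For `d = 0`, `Z` lies
in `S^∨`, which is closed under retracts. Otherwise `X` is the cone of `W ⟶ U` with `W` a retract of
`V ⊞ U`, for which the bound drops by one. -/
lemma cone_of_retract (wic : 𝓑.WIC) (d : ℕ) {X Z : C} (r : Retract X Z)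
    (hZ : 𝓑.cone (𝓑.finWedge S) (𝓑.finVee S) Z)
    (hd : ∀ (i : ℕ) (Y : C), d ≤ i → S Y → Subsingleton (𝓑.ExtSucc i Z Y)) :
    𝓑.cone (𝓑.finWedge S) (𝓑.finVee S) X := by
  induction d generalizing X Z with
  | zero =>
    obtain ⟨n, hn⟩ := hS.finVee_of_cone wic hZ fun i Y => hd i Y (Nat.zero_le i)
    exact hS.finVee_le_cone _ ⟨n, hS.vee_of_retract wic n r hn⟩
  | succ d ih =>
    obtain ⟨V, U, x, y, hV, hU, h⟩ := hZ
    obtain ⟨W, t, hW⟩ := IsDeflation.comp ⟨_, _, h⟩ (wic.isDeflation_retract r)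
    obtain ⟨δ', hW'⟩ := hW
    have hδ := h
    obtain ⟨δ, hδ⟩ := hδ
    obtain ⟨ρ⟩ := hδ.nonempty_retract_kernel r hW' (hS.extSucc_finVee_finWedge hU hV 0)
    have hVU : 𝓑.IsConflation (biprod.inl : V ⟶ V ⊞ U) biprod.snd := ⟨_, 𝓑.realizes_zero _ _⟩
    refine hS.cone_right hW'.isConflation (ih ρ ?_ fun i Y hi hY => ?_) (hS.finVee_le_cone _ hU)
    · exact hS.cone_middle hVU (hS.finWedge_le_cone _ hV) (hS.finVee_le_cone _ hU)
    · have hUY := hS.extSucc_finVee hU i Y hY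
      exact hVU.extSucc_middle_left (h.extSucc_left_left hUY (hd _ Y (by omega) hY)) hUY

/-- Finite projective dimension enters only through closure under retracts. -/
lemma isThick_cone (wic : 𝓑.WIC)
    (hd : ∀ X : C, ∃ d : ℕ, ∀ (i : ℕ) (Y : C), d ≤ i → Subsingleton (𝓑.ExtSucc i X Y)) :
    𝓑.IsThick (𝓑.cone (𝓑.finWedge S) (𝓑.finVee S)) where
  isSubcategory := isSummandClosedSubcategory_of_retract
    (fun h => hS.finVee_le_cone _ ⟨0, hS.isSubcategory.zero h⟩)
    (fun {X Z} r hZ => by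
      obtain ⟨d, hd⟩ := hd Z
      exact hS.cone_of_retract wic d r hZ fun i Y hi _ => hd i Y hi)
    fun _ _ => hS.cone_middle
  left _ _ := hS.cone_left
  middle _ _ := hS.cone_middle
  right _ _ := hS.cone_right

omit [𝓑.HasEnoughInjectives] in
/-- A coresolution of length `j + 1` can be shortened if the extension group that contains the
obstruction vanishes. -/
lemma vee_of_vee_succ (wic : 𝓑.WIC) {j : ℕ} {X : C} (hX : 𝓑.vee S (j + 1) X)
    (h : ∀ W : C, S W → Subsingleton (𝓑.ExtSucc j W X)) : 𝓑.vee S j X := by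
  induction j generalizing X with
  | zero =>
    obtain ⟨A, B, x, y, hA, hB, δ, hδ⟩ := hX
    obtain ⟨r, hr⟩ := hδ.exists_extend (a := 𝟙 X) ((h B hB).elim _ _)
    exact hS.isSubcategory.of_retract wic ⟨x, r, hr⟩ hA
  | succ j ih =>
    obtain ⟨A, B, x, y, hA, hB, hc⟩ := hX
    -- The obstruction for `B` in degree `j + 1` is controlled by that for `X` in degree `j + 2`.
    exact ⟨A, B, x, y, hA, ih hB fun W hW =>
      hc.extSucc_right_right (hS.ext_vanish j W A hW hA) (h W hW), hc⟩

end IsPresilting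

/-- If `S` is silting and all objects have finite projective dimension, then every projective
object has a finite `S`-coresolution. -/
lemma IsSilting.projectives_le_finVee [𝓑.HasEnoughInjectives] (hS : 𝓑.IsSilting S) (wic : 𝓑.WIC)
    (hd : ∀ X : C, ∃ d : ℕ, ∀ (i : ℕ) (Y : C), d ≤ i → Subsingleton (𝓑.ExtSucc i X Y)) :
    𝓑.projectives ≤ 𝓑.finVee S := fun P hP => by
  have hthick : 𝓑.thick S P := by rw [hS.thick_eq_top]; trivial
  refine hS.finVee_of_cone wic (hthick _ (hS.isThick_cone wic hd) fun X hX =>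
    hS.finVee_le_cone _ ⟨0, hX⟩) fun i Y _ => subsingleton_extSucc_of_projectives hP i Y

end Resolutions

/-! ### Projective dimension, and the comparison of silting with tilting. -/

section ProjectiveDimension

variable [𝓑.HasEnoughProjectives]

/-- `ExtSucc i` has degree `i + 1`, so degrees above `n` are the indices `i ≥ n`. -/
lemma pd_le_iff {X : C} {n : ℕ} :
    𝓑.pd X ≤ n ↔ ∀ (i : ℕ) (Y : C), n ≤ i → Subsingleton (𝓑.ExtSucc i X Y) := by
  rw [pd, sSup_le_iff]
  constructor
  · intro h i Y hi
    by_contra hY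
    have := h _ ⟨i, rfl, Y, not_subsingleton_iff_nontrivial.1 hY⟩
    norm_cast at this
    omega
  · rintro h _ ⟨i, rfl, Y, hY⟩
    by_contra hi
    norm_cast at hi
    exact not_subsingleton_iff_nontrivial.2 hY (h i Y (by omega))

lemma pd_lt_top_iff {X : C} :
    𝓑.pd X < ⊤ ↔ ∃ n : ℕ, ∀ (i : ℕ) (Y : C), n ≤ i → Subsingleton (𝓑.ExtSucc i X Y) := by
  simp only [← pd_le_iff]
  constructor
  · intro h
    lift 𝓑.pd X to ℕ using h.ne with n
    exact ⟨n, le_rfl⟩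
  · rintro ⟨n, hn⟩
    exact hn.trans_lt (ENat.natCast_lt_top n)

lemma pd_le_pdSubcategory {S : ObjectProperty C} {X : C} (hX : S X) :
    𝓑.pd X ≤ 𝓑.pdSubcategory S :=
  le_sSup ⟨X, hX, rfl⟩

lemma iterSyzygy_mem {T : ObjectProperty C} (hT : 𝓑.IsThick T) (hP : 𝓑.projectives ≤ T) {X : C}
    (n : ℕ) (h : T (𝓑.iterSyzygy n X)) : T X := by
  induction n with
  | zero => exact h
  | succ n ih =>
    obtain ⟨P, x, y, hPP, hx⟩ := 𝓑.exists_conflation_syzygy (𝓑.iterSyzygy n X)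
    exact ih (hT.right x y hx h (hP _ hPP))

lemma thick_eq_top_of_projectives_le {S : ObjectProperty C} (hpd : ∀ X : C, 𝓑.pd X < ⊤)
    (hS : 𝓑.projectives ≤ 𝓑.thick S) : 𝓑.thick S = ⊤ := by
  refine top_unique fun X _ T hT hST => ?_
  have hP : 𝓑.projectives ≤ T := fun P hP => hS P hP T hT hST
  obtain ⟨n, hn⟩ := pd_lt_top_iff.1 (hpd X)
  -- Vanishing of `𝔼(Ω^n X, -)` makes `Ω^n X` projective; thickness then climbs back to `X`.
  exact iterSyzygy_mem hT hP n
    (hP _ (projectives_of_subsingleton_ext fun A => hn n A le_rfl))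

lemma IsNTilting.isPresilting {n : ℕ} {T : ObjectProperty C} (hT : 𝓑.IsNTilting n T) :
    𝓑.IsPresilting T where
  isSubcategory := hT.isSubcategory
  ext_vanish i X Y hX hY := by
    rcases lt_or_ge i n with hi | hi
    · exact hT.ext_vanish i hi X Y hX hY
    · exact pd_le_iff.1 ((pd_le_pdSubcategory hX).trans hT.pd_le) i Y hi

lemma IsNTilting.isSilting {n : ℕ} {T : ObjectProperty C} (hT : 𝓑.IsNTilting n T)
    (hpd : ∀ X : C, 𝓑.pd X < ⊤) : 𝓑.IsSilting T where
  toIsPresilting := hT.isPresilting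
  thick_eq_top := thick_eq_top_of_projectives_le hpd
    (hT.projectives_le.trans (vee_le_thick n))

variable [𝓑.HasEnoughInjectives]

variable (𝓑) in
lemma isThick_pd_lt_top : 𝓑.IsThick fun X => 𝓑.pd X < ⊤ := by
  have hmid : ∀ {A B Z : C} (x : A ⟶ B) (y : B ⟶ Z), 𝓑.IsConflation x y → 𝓑.pd A < ⊤ →
      𝓑.pd Z < ⊤ → 𝓑.pd B < ⊤ := by
    intro A B Z x y h hA hZ
    rw [pd_lt_top_iff] at *
    obtain ⟨m, hm⟩ := hA
    obtain ⟨n, hn⟩ := hZ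
    exact ⟨m + n, fun i Y hi =>
      h.extSucc_middle_left (hm i Y (by omega)) (hn i Y (by omega))⟩
  refine ⟨isSummandClosedSubcategory_of_retract ?_ ?_ hmid, ?_, hmid, ?_⟩
  · intro X hX
    rw [pd_lt_top_iff]
    exact ⟨0, fun i Y _ => (subsingleton_extSucc_iff _ _ _).2
      (𝓑.subsingleton_of_isZero_left hX _)⟩
  · intro X Z r hZ
    rw [pd_lt_top_iff] at *
    obtain ⟨n, hn⟩ := hZ
    exact ⟨n, fun i Y hi => subsingleton_extSucc_of_retract r (hn i Y hi)⟩
  · intro A B Z x y h hB hZ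
    rw [pd_lt_top_iff] at *
    obtain ⟨m, hm⟩ := hB
    obtain ⟨n, hn⟩ := hZ
    exact ⟨m + n, fun i Y hi => h.extSucc_left_left (hm i Y (by omega)) (hn _ Y (by omega))⟩
  · intro A B Z x y h hA hB
    rw [pd_lt_top_iff] at *
    obtain ⟨m, hm⟩ := hA
    obtain ⟨n, hn⟩ := hB
    -- The extra `1` pays for the connecting map, which raises the degree from `A` to `Z`.
    refine ⟨m + n + 1, fun i Y hi => ?_⟩
    obtain ⟨i, rfl⟩ : ∃ j, i = j + 1 := ⟨i - 1, by omega⟩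
    exact h.extSucc_right_left (hm i Y (by omega)) (hn _ Y (by omega))

/-- If some silting subcategory has finite projective dimension, then so does every object. -/
lemma IsSilting.pd_lt_top {S : ObjectProperty C} (hS : 𝓑.IsSilting S)
    (hpd : 𝓑.pdSubcategory S < ⊤) (X : C) : 𝓑.pd X < ⊤ := by
  have hX : 𝓑.thick S X := by rw [hS.thick_eq_top]; trivial
  exact hX _ 𝓑.isThick_pd_lt_top fun Y hY => (pd_le_pdSubcategory hY).trans_lt hpd

lemma IsSilting.isNTilting {S : ObjectProperty C} (hS : 𝓑.IsSilting S) (wic : 𝓑.WIC) {n : ℕ}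
    (hn : 1 ≤ n) (hpd : ∀ X : C, 𝓑.pd X ≤ n) : 𝓑.IsNTilting n S where
  isSubcategory := hS.isSubcategory
  one_le := hn
  pd_le := sSup_le (by rintro _ ⟨X, -, rfl⟩; exact hpd X)
  ext_vanish j _ := hS.ext_vanish j
  projectives_le P hP := by
    obtain ⟨m, hm⟩ := hS.projectives_le_finVee wic (fun X => ⟨n, pd_le_iff.1 (hpd X)⟩) P hP
    rcases le_total m n with h | h
    · exact monotone_vee hS.isSubcategory h _ hm
    · induction m, h using Nat.le_induction with
      | base => exact hm
      | succ j hj ih =>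
        -- For `j ≥ n` the obstruction to shortening lies above the projective dimension of `W`.
        exact ih (hS.vee_of_vee_succ wic hm fun W _ => pd_le_iff.1 (hpd W) j P hj)

end ProjectiveDimension

end Extriangulation

theorem theorem5p5 {k : Type*} [Field k] {C : Type u} [Category.{v} C] [Preadditive C]
    [HasZeroObject C] [HasBinaryBiproducts C] [Linear k C]
    (hom_finite : ∀ X Y : C, Module.Finite k (X ⟶ Y)) (krull_schmidt : IsKrullSchmidt C)
    (𝓑 : Extriangulation.{w} C) [𝓑.HasEnoughProjectives] [𝓑.HasEnoughInjectives]
    (wic : 𝓑.WIC) :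
    ((∀ X : C, 𝓑.pd X < ⊤) → 𝓑.tilt ⊆ 𝓑.silt) ∧
    (𝓑.pdSubcategory ⊤ < ⊤ → 𝓑.silt = 𝓑.tilt) ∧
    ((∃ X : C, 𝓑.pd X = ⊤) → 𝓑.silt ∩ 𝓑.tilt = ∅) := by
  refine ⟨fun hpd T ⟨n, hT⟩ => hT.isSilting hpd, fun hpd => ?_, ?_⟩
  · have hX (X : C) : 𝓑.pd X ≤ 𝓑.pdSubcategory ⊤ := Extriangulation.pd_le_pdSubcategory trivial
    refine Set.Subset.antisymm (fun S hS => ?_)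
      (fun T ⟨n, hT⟩ => hT.isSilting fun X => (hX X).trans_lt hpd)
    obtain ⟨n, hn⟩ := ENat.ne_top_iff_exists.1 hpd.ne
    -- `n` may be `0`, while tilting asks for a bound of at least `1`.
    exact ⟨n + 1, Extriangulation.IsSilting.isNTilting hS wic (by omega) fun X =>
      (hX X).trans (by rw [← hn]; exact_mod_cast n.le_succ)⟩
  · rintro ⟨X, hX⟩
    refine Set.eq_empty_of_forall_notMem fun S ⟨hS, n, hT⟩ => ?_
    exact (Extriangulation.IsSilting.pd_lt_top hS
      (hT.pd_le.trans_lt (ENat.natCast_lt_top n)) X).ne hX
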